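/- A fire and $f$ firefighters act on an oriented graph $\overrightarrow{G}$ as follows. At time $1$ a fire breaks out at a vertex. At each time $t \ge 1$, immediately after the vertices of time $t$ have started burning, the firefighters permanently protect at most $f$ vertices that are not burnt; then, at time $t+1$, the fire spreads from every burnt vertex to all of its unprotected outneighbours. Let $\beta(\overrightarrow{G},f)$ be the maximum, over all vertices $v$ of $\overrightarrow{G}$, of the number of vertices that eventually burn under an optimal firefighting strategy when the fire breaks out at $v$. For an undirected graph $G$, let $\overrightarrow{\beta}(G,f)$ be the minimum of $\beta(\overrightarrow{G},f)$ over all orientations $\overrightarrow{G}$ of $G$. **Proposition 5.7.** For every finite simple graph $G$ of maximum degree at most $4$, we have $\overrightarrow{\beta}(G,1)\le 5$. That is, $G$ has an orientation such that, wherever the fire breaks out, one firefighter has a strategy under which at most $5$ vertices burn. -/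

import Mathlib

namespace Firefighter

/-- The digraph `D` is an orientation of the simple graph `G`: every edge of `G` is replaced by
exactly one of its two possible arcs, and `D` has no other arcs. -/
def IsOrientation {V : Type*} (G : SimpleGraph V) (D : Digraph V) : Prop :=
  (∀ u v, G.Adj u v ↔ D.Adj u v ∨ D.Adj v u) ∧ ∀ u v, D.Adj u v → ¬ D.Adj v u

/-- `burnt D P v t` is the set of vertices burnt after `t` spreading steps, when the fire breaks
out at `v` at step `0` and the set `P s` is protected (permanently) immediately after step `s`,
hence before step `s + 1`.  In each step the fire spreads from every burnt vertex to all of its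
outneighbours that have not been protected so far. -/
def burnt {V : Type*} (D : Digraph V) (P : ℕ → Finset V) (v : V) : ℕ → Set V
  | 0 => {v}
  | t + 1 => burnt D P v t ∪
      {w | (∃ u ∈ burnt D P v t, D.Adj u w) ∧ ∀ s ≤ t, w ∉ P s}

/-- `P` is a legal play for `f` firefighters against a fire that breaks out at `v`: at each time
at most `f` vertices are protected, none of which is already burnt.  Since the fire
is deterministic once `D` and `v` are known, such a sequence is the same as a strategy. -/
def IsStrategy {V : Type*} (D : Digraph V) (f : ℕ) (v : V) (P : ℕ → Finset V) : Prop :=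
  ∀ t, (P t).card ≤ f ∧ ∀ w ∈ P t, w ∉ burnt D P v t

/-- The set of all vertices that ever burn. -/
def finalBurnt {V : Type*} (D : Digraph V) (P : ℕ → Finset V) (v : V) : Set V :=
  ⋃ t, burnt D P v t

/-- The number of vertices of `D` that burn under an optimal strategy of `f` firefighters when
the fire breaks out at `v`. -/
noncomputable def betaAt {V : Type*} (D : Digraph V) (f : ℕ) (v : V) : ℕ∞ :=
  ⨅ (P : ℕ → Finset V) (_ : IsStrategy D f v P), (finalBurnt D P v).encard

/-- `β(D, f)`: the maximum, over all vertices where the fire may break out, of the number of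
vertices of `D` that burn under an optimal strategy of `f` firefighters. -/
noncomputable def beta {V : Type*} (D : Digraph V) (f : ℕ) : ℕ∞ :=
  ⨆ v : V, betaAt D f v

/-- The oriented firefighter number of `G`: the minimum of `β(D, f)` over all orientations `D`
of `G`. -/
noncomputable def orientedBeta {V : Type*} (G : SimpleGraph V) (f : ℕ) : ℕ∞ :=
  ⨅ (D : Digraph V) (_ : IsOrientation G D), beta D f

end Firefighter

/-!
Let `A` be a maximum independent set of `G`. Every vertex outside `A` has a neighbour in `A`, so the
graph `H` induced on the complement of `A` has maximum degree at most `3`. All edges between `A` and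
its complement are oriented towards `A`, so the vertices of `A` are sinks and each of them costs the
firefighter a single vertex. The graph `H` is oriented so that each vertex `s` either has at most
one outneighbour in `H`, or has exactly two, `t` and `d`, where `t` has at most one outneighbour in
`H` and `s` has an inneighbour in `H` (`exists_orientation_of_degree_le_three`).

If the fire starts at a vertex of the first kind, its outneighbour in `H` is protected, and only
sinks burn besides, at most three of them (`betaAt_one_le_of_unique_arc_off_sinks`). If it starts at
`s` of the second kind, `d` is protected, so `t` and at most one sink burn in the first step; then
the outneighbour of `t` in `H` is protected, or one of the sinks if there is none, and at most two
more sinks burn. In total that makes `5` (`betaAt_one_le_of_two_arcs_off_sinks`).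

For the orientation of `H`, take a minimal set `F` of edges that covers the vertices of degree `3`.
By minimality each edge of `F` has an endpoint of degree `3` that no other edge of `F` covers, and
it is oriented away from such an endpoint; then no head of an arc of `F` is the tail of another one.
The remaining edges form a graph of maximum degree at most `2`, and by Hall's theorem one can choose
distinct endpoints as the tails of its edges.
-/

namespace Firefighter

open Finset

/-! ### Orientations of graphs of small maximum degree -/

/-- Hall's condition for choosing distinct endpoints of the edges holds by double counting: every
edge has two endpoints and every vertex lies on at most two edges. -/
theorem exists_orientation_outdegree_le_one {V : Type*} [Fintype V]
    (K : SimpleGraph V) [DecidableRel K.Adj] (hK : ∀ v, K.degree v ≤ 2) :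
    ∃ D : Digraph V, IsOrientation K D ∧ ∀ u w w', D.Adj u w → D.Adj u w' → w = w' := by
  classical
  have hall : ∀ s : Finset K.edgeSet, #s ≤ #(s.biUnion fun e => (e : Sym2 V).toFinset) := by
    intro s
    have hdc := card_mul_le_card_mul (s := s) (t := s.biUnion fun e => (e : Sym2 V).toFinset)
      (fun (e : K.edgeSet) (v : V) => v ∈ (e : Sym2 V)) (m := 2) (n := 2) ?_ ?_
    · omega
    · intro e he
      rw [← Sym2.card_toFinset_of_not_isDiag (e : Sym2 V) (K.not_isDiag_of_mem_edgeSet e.2)]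
      apply card_le_card
      intro v hv
      rw [mem_bipartiteAbove]
      exact ⟨mem_biUnion.2 ⟨e, he, hv⟩, Sym2.mem_toFinset.1 hv⟩
    · intro v _
      refine le_trans ?_ (hK v)
      rw [← K.card_incidenceFinset_eq_degree v,
        ← card_image_of_injective _ (Subtype.val_injective (p := fun e => e ∈ K.edgeSet))]
      apply card_le_card
      intro e' he'
      obtain ⟨e, he, rfl⟩ := mem_image.1 he'
      rw [K.mem_incidenceFinset]
      exact ⟨e.2, ((mem_bipartiteBelow _).1 he).2⟩
  obtain ⟨f, hf, hfe⟩ := (all_card_le_biUnion_card_iff_exists_injective _).1 hall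
  refine ⟨⟨fun u w => ∃ h : K.Adj u w, f ⟨s(u, w), h⟩ = u⟩, ⟨fun u w => ⟨fun h => ?_, ?_⟩, ?_⟩, ?_⟩
  · have := Sym2.mem_iff.1 (Sym2.mem_toFinset.1 (hfe ⟨s(u, w), h⟩))
    rcases this with h1 | h1
    · exact Or.inl ⟨h, h1⟩
    · refine Or.inr ⟨h.symm, ?_⟩
      exact (congrArg f (Subtype.ext Sym2.eq_swap)).trans h1
  · rintro (⟨h, _⟩ | ⟨h, _⟩)
    exacts [h, h.symm]
  · rintro u w ⟨h, h1⟩ ⟨h', h2⟩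
    apply h.ne
    exact h1.symm.trans ((congrArg f (Subtype.ext Sym2.eq_swap)).trans h2)
  · rintro u w w' ⟨h, h1⟩ ⟨h', h2⟩
    have := Subtype.ext_iff.1 (hf (h1.trans h2.symm))
    exact Sym2.congr_right.1 this

/-- Take for `F` a minimal set of edges of `H` that covers `S`. By minimality each of its edges has
an endpoint in `S` that no other edge of `F` covers, and `A` orients the edge away from such an
endpoint. A head of an arc cannot be the tail of another arc, as it is covered by the first. -/
theorem exists_cover_oriented_from_private_endpoints {V : Type*} [Finite V]
    (H : SimpleGraph V) (S : Set V) (hS : ∀ v ∈ S, ∃ w, H.Adj v w) :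
    ∃ (F : SimpleGraph V) (A : Digraph V), F ≤ H ∧ (∀ v ∈ S, ∃ w, F.Adj v w) ∧
      IsOrientation F A ∧ (∀ u w, A.Adj u w → u ∈ S ∧ ∀ x, F.Adj u x → x = w) ∧
      ∀ u w x, A.Adj u w → ¬ A.Adj w x := by
  classical
  let C : Set (SimpleGraph V) := {F | F ≤ H ∧ ∀ v ∈ S, ∃ w, F.Adj v w}
  obtain ⟨F, hFm⟩ := C.toFinite.exists_minimal ⟨H, le_rfl, hS⟩
  obtain ⟨hFH, hcov⟩ := hFm.prop
  -- Otherwise the edge `uw` could be deleted from `F`.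
  have hpriv : ∀ u w, F.Adj u w → (u ∈ S ∧ ∀ x, F.Adj u x → x = w) ∨
      (w ∈ S ∧ ∀ x, F.Adj w x → x = u) := by
    intro u w huw
    by_contra! hcon
    have hF' : F.deleteEdges {s(u, w)} ∈ C := by
      refine ⟨(F.deleteEdges_le _).trans hFH, fun v hv => ?_⟩
      simp only [SimpleGraph.deleteEdges_adj, Set.mem_singleton_iff, Sym2.eq_iff]
      obtain ⟨x, hx⟩ := hcov v hv
      by_cases hvu : v = u
      · subst hvu
        obtain ⟨y, hy, hne⟩ := hcon.1 hv
        exact ⟨y, hy, by grind⟩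
      · by_cases hvw : v = w
        · subst hvw
          obtain ⟨y, hy, hne⟩ := hcon.2 hv
          exact ⟨y, hy, by grind⟩
        · exact ⟨x, hx, by grind⟩
    have := hFm.le_of_le hF' (F.deleteEdges_le _) huw
    simp at this
  -- `T u w`: the endpoint `u` is private to the edge `uw`. An injection of `V` into an ordered
  -- type breaks the tie when both endpoints are private.
  let T : V → V → Prop := fun u w => F.Adj u w ∧ u ∈ S ∧ ∀ x, F.Adj u x → x = w
  let g := Finite.equivFin V
  let A : V → V → Prop := fun u w => T u w ∧ (T w u → g u < g w)
  have hasymm : ∀ u w, A u w → ¬ A w u := fun u w h h' => lt_asymm (h.2 h'.1) (h'.2 h.1)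
  refine ⟨F, ⟨A⟩, hFH, hcov, ⟨fun u w => ⟨fun h => ?_, ?_⟩, hasymm⟩, fun u w h => h.1.2, ?_⟩
  · have hne : g u ≠ g w := fun e => h.ne (g.injective e)
    have := hpriv u w h
    have := h.symm
    change A u w ∨ A w u
    grind
  · rintro (h | h)
    exacts [h.1.1, h.1.1.symm]
  · intro u w x h h'
    have : u = x := h'.1.2.2 u h.1.1.symm
    exact hasymm u w h (this ▸ h')

/-- The arc from `s` to `t` comes from a minimal cover of the vertices of degree `3`, and the arc
from `s` to `d` from an orientation with outdegrees at most `1` of the remaining edges. -/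
theorem exists_orientation_of_degree_le_three {V : Type*} [Fintype V]
    (H : SimpleGraph V) [DecidableRel H.Adj] (hH : ∀ v, H.degree v ≤ 3) :
    ∃ D : Digraph V, IsOrientation H D ∧ ∀ s,
      (∀ w w', D.Adj s w → D.Adj s w' → w = w') ∨
      ∃ r t d, D.Adj r s ∧ D.Adj s t ∧ D.Adj s d ∧ t ≠ d ∧
        (∀ w, D.Adj s w → w = t ∨ w = d) ∧ ∀ w w', D.Adj t w → D.Adj t w' → w = w' := by
  classical
  obtain ⟨F, A, hFH, hcov, ⟨hA, -⟩, hpriv, hpath⟩ :=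
    exists_cover_oriented_from_private_endpoints H {v | H.degree v = 3} fun v hv =>
      (H.degree_pos_iff_exists_adj v).1 (by have : H.degree v = 3 := hv; omega)
  have hdeg : ∀ v, (H \ F).degree v ≤ 2 := by
    intro v
    have hsub : (H \ F).neighborFinset v ⊆ H.neighborFinset v := by
      intro x; simp +contextual
    have hle := card_le_card hsub
    simp only [SimpleGraph.card_neighborFinset_eq_degree] at hle
    by_cases h3 : H.degree v = 3
    · obtain ⟨w, hw⟩ := hcov v h3
      have hlt : (H \ F).neighborFinset v ⊂ H.neighborFinset v := by
        refine hsub.ssubset_of_mem_notMem (a := w) ?_ ?_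
        · simpa using hFH hw
        · simp [hw]
      have := card_lt_card hlt
      simp only [SimpleGraph.card_neighborFinset_eq_degree] at this
      omega
    · have := hH v
      omega
  obtain ⟨D₀, ⟨hD₀, hD₀'⟩, huniq⟩ := exists_orientation_outdegree_le_one (H \ F) hdeg
  have hF : ∀ u w, A.Adj u w → F.Adj u w := fun u w h => (hA u w).2 (Or.inl h)
  have hsd : ∀ u w, D₀.Adj u w → H.Adj u w ∧ ¬ F.Adj u w := fun u w h =>
    (SimpleGraph.sdiff_adj ..).1 ((hD₀ u w).2 (Or.inl h))
  have hor : ∀ u v, H.Adj u v ↔ (D₀.Adj u v ∨ A.Adj u v) ∨ (D₀.Adj v u ∨ A.Adj v u) := by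
    intro u v
    rw [or_or_or_comm, ← hD₀, ← hA, SimpleGraph.sdiff_adj]
    by_cases h : F.Adj u v
    · simp [h, hFH h]
    · simp [h]
  refine ⟨⟨fun u w => D₀.Adj u w ∨ A.Adj u w⟩, ⟨hor, ?_⟩, fun s => ?_⟩
  · rintro u v (h | h) (h' | h')
    · exact hD₀' u v h h'
    · exact (hsd u v h).2 (hF v u h').symm
    · exact (hsd v u h').2 (hF u v h).symm
    · exact hpath u v u h h'
  by_cases hs : ∃ t, A.Adj s t
  · obtain ⟨t, hst⟩ := hs
    by_cases hd : ∃ d, D₀.Adj s d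
    · obtain ⟨d, hsd'⟩ := hd
      right
      have hout : ∀ w, D₀.Adj s w ∨ A.Adj s w → w = t ∨ w = d := by
        rintro w (h | h)
        · exact Or.inr (huniq _ _ _ h hsd')
        · exact Or.inl ((hpriv s t hst).2 w (hF s w h))
      have hin : ∃ r, D₀.Adj r s ∨ A.Adj r s := by
        by_contra! hno
        have hle : #(H.neighborFinset s) ≤ #({t, d} : Finset V) := by
          apply card_le_card
          intro w hw
          rcases (hor s w).1 (by simpa using hw) with h | h | h
          · simpa using hout w h
          · exact absurd h (hno w).1
          · exact absurd h (hno w).2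
        rw [SimpleGraph.card_neighborFinset_eq_degree, (hpriv s t hst).1] at hle
        have := hle.trans card_le_two
        omega
      obtain ⟨r, hr⟩ := hin
      refine ⟨r, t, d, hr, Or.inr hst, Or.inl hsd', ?_, hout, ?_⟩
      · rintro rfl
        exact (hsd _ _ hsd').2 (hF _ _ hst)
      · rintro w w' (h | h) (h' | h')
        · exact huniq _ _ _ h h'
        all_goals exact absurd ‹A.Adj t _› (hpath s t _ hst)
    · left
      rintro w w' (h | h) (h' | h')
      any_goals exact absurd ⟨_, ‹D₀.Adj s _›⟩ hd
      exact (hpriv s w' h').2 w (hF s w h)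
  · left
    rintro w w' (h | h) (h' | h')
    · exact huniq _ _ _ h h'
    all_goals exact absurd ⟨_, ‹A.Adj s _›⟩ hs

/-! ### Strategies with two protections -/

/-- The firefighter protects `p` at time `0` and `q` at time `1`, and nothing afterwards. The
hypothesis `hpq` says that the vertices of `q` do not burn at time `1`. By `hv` and `hS`, the fire
never leaves `S`; an outneighbour of `v` must lie in `S` or `p`, because `q` is protected only after
the first spreading step. -/
theorem betaAt_one_le_of_two_protections {V : Type*} {D : Digraph V} {v : V}
    {p q S : Finset V} (hp : #p ≤ 1) (hq : #q ≤ 1) (hvp : v ∉ p) (hvq : v ∉ q)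
    (hpq : ∀ w ∈ q, D.Adj v w → w ∈ p) (hvS : v ∈ S) (hv : ∀ w, D.Adj v w → w ∈ S ∨ w ∈ p)
    (hS : ∀ u ∈ S, ∀ w, D.Adj u w → w ∈ S ∨ w ∈ p ∨ w ∈ q) :
    betaAt D 1 v ≤ #S := by
  classical
  let P : ℕ → Finset V := fun t => if t = 0 then p else if t = 1 then q else ∅
  have hP : IsStrategy D 1 v P := by
    rintro (_ | _ | t)
    · exact ⟨by simpa [P] using hp, fun w hw => by
        rintro rfl; exact hvp (by simpa [P] using hw)⟩
    · refine ⟨by simpa [P] using hq, fun w hw => ?_⟩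
      replace hw : w ∈ q := by simpa [P] using hw
      rintro (h | ⟨⟨u, hu, huw⟩, h⟩)
      · obtain rfl : w = v := h
        exact hvq hw
      · obtain rfl : u = v := hu
        exact h 0 le_rfl (by simpa [P] using hpq w hw huw)
    · simp [P]
  have hb : ∀ t, burnt D P v t ⊆ S := by
    intro t
    induction t with
    | zero => simpa [burnt] using hvS
    | succ t ih =>
      rintro w (h | ⟨⟨u, hu, huw⟩, h⟩)
      · exact ih h
      · have h0 : w ∉ p := by simpa [P] using h 0 (Nat.zero_le _)
        cases t with
        | zero =>
          obtain rfl : u = v := hu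
          exact mem_coe.2 ((hv w huw).resolve_right h0)
        | succ t =>
          have h1 : w ∉ q := by simpa [P] using h 1 (by omega)
          have := hS u (mem_coe.1 (ih hu)) w huw
          exact mem_coe.2 (by tauto)
  calc betaAt D 1 v ≤ (finalBurnt D P v).encard := iInf₂_le P hP
    _ ≤ (S : Set V).encard := Set.encard_le_encard (Set.iUnion_subset hb)
    _ = #S := Set.encard_coe_eq_coe_finsetCard S

/-- If the fire threatens the set `X`, of which at most one vertex lies outside the set `A` of
sinks, and the sinks in `N` are already lost, then protecting a suitable set `q` of at most one
vertex leaves at most `n` vertices outside `N` to burn, all of them sinks. -/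
theorem exists_guard {V : Type*} [DecidableEq V] {A X N : Finset V} {n : ℕ}
    (hX : ∀ w ∈ X, ∀ w' ∈ X, w ∉ A → w' ∉ A → w = w') (hN : N ⊆ A) (hn : #X ≤ n + 1) :
    ∃ q ⊆ X, #q ≤ 1 ∧ Disjoint q N ∧ X \ q ⊆ A ∧ #((X \ q) \ N) ≤ n := by
  have key : ∀ x ∈ X, x ∉ N → X \ {x} ⊆ A →
      ∃ q ⊆ X, #q ≤ 1 ∧ Disjoint q N ∧ X \ q ⊆ A ∧ #((X \ q) \ N) ≤ n := by
    intro x hx hxN hxA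
    refine ⟨{x}, by simpa, by simp, by simpa, hxA, (card_le_card sdiff_subset).trans ?_⟩
    rw [card_sdiff_of_subset (by simpa), card_singleton]
    omega
  by_cases h : X ⊆ A
  · by_cases hXN : X ⊆ N
    · exact ⟨∅, by simp, by simp, by simp, by simpa, by simp [sdiff_eq_empty_iff_subset.2 hXN]⟩
    · obtain ⟨x, hx, hxN⟩ := not_subset.1 hXN
      exact key x hx hxN (sdiff_subset.trans h)
  · obtain ⟨x, hx, hxA⟩ := not_subset.1 h
    refine key x hx (fun hxN => hxA (hN hxN)) fun w hw => ?_
    rw [mem_sdiff, mem_singleton] at hw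
    by_contra hwA
    exact hw.2 (hX w hw.1 x hx hwA hxA)

/-! ### Fires in digraphs with many sinks -/

section Sinks

variable {V : Type*} [Fintype V] [DecidableEq V] {D : Digraph V} [DecidableRel D.Adj]
  {A : Finset V}

/-- Once the only outneighbour of `s` that is not a sink is protected, the fire dies out after one
step. -/
theorem betaAt_one_le_of_unique_arc_off_sinks (hA : ∀ a ∈ A, ∀ w, ¬ D.Adj a w) {s : V}
    (hout : #(univ.filter (D.Adj s)) ≤ 4) (hss : ¬ D.Adj s s)
    (hs : ∀ w w', D.Adj s w → D.Adj s w' → w ∉ A → w' ∉ A → w = w') :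
    betaAt D 1 s ≤ 5 := by
  obtain ⟨p, hpX, hp, -, hpA, hcard⟩ :=
    exists_guard (X := univ.filter (D.Adj s)) (N := ∅) (n := 3)
      (by simpa using fun w h w' h' => hs w w' h h') (empty_subset A) hout
  rw [sdiff_empty] at hcard
  have hv : ∀ w, D.Adj s w → w ∈ insert s (univ.filter (D.Adj s) \ p) ∨ w ∈ p := by
    intro w hw
    by_cases h : w ∈ p <;> simp [h, hw]
  refine (betaAt_one_le_of_two_protections (q := ∅) (S := insert s (univ.filter (D.Adj s) \ p))
    hp (by simp) (fun h => hss (by simpa using hpX h)) (by simp) (by simp)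
    (mem_insert_self _ _) hv ?_).trans ?_
  · intro u hu w huw
    rcases mem_insert.1 hu with rfl | hu
    · exact (hv w huw).imp_right Or.inl
    · exact absurd huw (hA u (hpA hu) w)
  · have := card_insert_le s (univ.filter (D.Adj s) \ p)
    exact_mod_cast this.trans (by omega)

/-- The firefighter protects `d`, lets `t` burn, and guards the outneighbours of `t`. -/
theorem betaAt_one_le_of_two_arcs_off_sinks (hA : ∀ a ∈ A, ∀ w, ¬ D.Adj a w)
    (hasymm : ∀ u w, D.Adj u w → ¬ D.Adj w u) {s t d : V}
    (hst : D.Adj s t) (hsd : D.Adj s d) (htd : t ≠ d)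
    (hs : ∀ w, D.Adj s w → w ∉ A → w = t ∨ w = d)
    (ht : ∀ w w', D.Adj t w → D.Adj t w' → w ∉ A → w' ∉ A → w = w')
    (hsout : #(univ.filter (D.Adj s)) ≤ 3) (htout : #(univ.filter (D.Adj t)) ≤ 3) :
    betaAt D 1 s ≤ 5 := by
  have hirr : ∀ u, ¬ D.Adj u u := fun u h => hasymm u u h h
  -- `N` is the set of sinks that burn in the first step, and `R` the set of those that burn in the
  -- second one.
  set N : Finset V := univ.filter (D.Adj s) \ {t, d} with hN
  have hNA : N ⊆ A := by
    intro w hw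
    simp only [hN, mem_sdiff, mem_filter_univ, mem_insert, mem_singleton] at hw
    by_contra h
    exact hw.2 (hs w hw.1 h)
  have hNcard : #N ≤ 1 := by
    rw [hN, card_sdiff_of_subset (by simp [insert_subset_iff, hst, hsd]), card_pair htd]
    omega
  obtain ⟨q, hqX, hq, hqN, hqA, hcard⟩ := exists_guard (X := univ.filter (D.Adj t)) (n := 2)
    (by simpa using fun w h w' h' => ht w w' h h') hNA htout
  have hqt : ∀ w ∈ q, D.Adj t w := fun w hw => by simpa using hqX hw
  set R : Finset V := (univ.filter (D.Adj t) \ q) \ N with hR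
  have hv : ∀ w, D.Adj s w → w ∈ {s, t} ∪ N ∪ R ∨ w ∈ ({d} : Finset V) := by
    intro w hw
    by_cases h1 : w = t
    · simp [h1]
    · by_cases h2 : w = d
      · simp [h2]
      · simp [hN, h1, h2, hw]
  refine (betaAt_one_le_of_two_protections (p := {d}) (q := q) (S := {s, t} ∪ N ∪ R)
    (by simp) hq ?_ (fun h => hasymm _ _ hst (hqt s h)) ?_ (by simp) hv ?_).trans ?_
  · rw [mem_singleton]
    rintro rfl
    exact hirr _ hsd
  · intro w hw hsw
    have h1 : w ≠ t := by
      rintro rfl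
      exact hirr _ (hqt _ hw)
    have h2 : w ∉ N := disjoint_left.1 hqN hw
    simpa [hN, hsw, h1] using h2
  · intro u hu w huw
    simp only [mem_union, mem_insert, mem_singleton] at hu
    rcases hu with ((rfl | rfl) | hu) | hu
    · exact (hv w huw).imp_right Or.inl
    · by_cases h1 : w ∈ q
      · exact Or.inr (Or.inr h1)
      · by_cases h2 : w ∈ N <;> simp [hR, h1, h2, huw]
    · exact absurd huw (hA u (hNA hu) w)
    · exact absurd huw (hA u (hqA (mem_sdiff.1 hu).1) w)
  · have h1 := card_union_le ({s, t} ∪ N) R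
    have h2 := card_union_le {s, t} N
    have h3 := card_le_two (a := s) (b := t)
    exact_mod_cast h1.trans (by omega)

end Sinks

end Firefighter

theorem proposition5p7 {V : Type*} [Fintype V] (G : SimpleGraph V) [DecidableRel G.Adj]
    (hG : G.maxDegree ≤ 4) : Firefighter.orientedBeta G 1 ≤ 5 := by
  classical
  obtain ⟨A, hAmax⟩ := G.maximumIndepSet_exists
  have hind := hAmax.isIndepSet
  have hdom : ∀ v, v ∉ A → ∃ a ∈ A, G.Adj v a := by
    intro v hv
    by_contra! hno
    have hins : G.IsIndepSet (insert v A : Finset V) := by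
      rw [Finset.coe_insert]
      exact Set.Pairwise.insert hind fun a ha _ => ⟨hno a ha, fun h => hno a ha h.symm⟩
    have := hAmax.maximum _ hins
    rw [Finset.card_insert_of_notMem hv] at this
    omega
  have hcard : ∀ (v : V) (X : Finset V), (∀ w ∈ X, G.Adj v w) → X.card ≤ 4 := by
    intro v X hX
    refine le_trans ?_ ((G.degree_le_maxDegree v).trans hG)
    rw [← G.card_neighborFinset_eq_degree]
    exact Finset.card_le_card fun w hw => by simpa using hX w hw
  -- The graph induced on the complement of `A`, with the vertices of `A` kept as isolated ones.
  let H : SimpleGraph V :=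
    { Adj := fun u v => G.Adj u v ∧ u ∉ A ∧ v ∉ A
      symm := ⟨fun u v h => ⟨h.1.symm, h.2.2, h.2.1⟩⟩
      loopless := ⟨fun u h => G.loopless.irrefl u h.1⟩ }
  have hH : ∀ v, H.degree v ≤ 3 := by
    intro v
    rw [← H.card_neighborFinset_eq_degree]
    by_cases hv : v ∈ A
    · have : H.neighborFinset v = ∅ := by
        ext w
        simp [H, hv]
      simp [this]
    · obtain ⟨a, ha, hva⟩ := hdom v hv
      have hna : a ∉ H.neighborFinset v := by simp [H, ha]
      have := hcard v (insert a (H.neighborFinset v)) (by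
        intro w hw
        rcases Finset.mem_insert.1 hw with rfl | hw
        · exact hva
        · exact ((H.mem_neighborFinset v w).1 hw).1)
      rw [Finset.card_insert_of_notMem hna] at this
      omega
  obtain ⟨E, ⟨hE, hE'⟩, hEs⟩ := Firefighter.exists_orientation_of_degree_le_three H hH
  have hEH : ∀ u v, E.Adj u v → G.Adj u v ∧ u ∉ A ∧ v ∉ A := fun u v h =>
    (hE u v).2 (Or.inl h)
  let D : Digraph V := ⟨fun u v => E.Adj u v ∨ (G.Adj u v ∧ u ∉ A ∧ v ∈ A)⟩
  have hDG : ∀ u v, D.Adj u v → G.Adj u v := by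
    rintro u v (h | h)
    exacts [(hEH u v h).1, h.1]
  have hDA : ∀ a ∈ A, ∀ w, ¬ D.Adj a w := by
    rintro a ha w (h | h)
    exacts [(hEH a w h).2.1 ha, h.2.1 ha]
  have hDE : ∀ u v, D.Adj u v → v ∉ A → E.Adj u v := by
    rintro u v (h | h) hv
    exacts [h, absurd h.2.2 hv]
  have hasymm : ∀ u v, D.Adj u v → ¬ D.Adj v u := by
    intro u v h h'
    have hu : u ∉ A := fun hu => hDA u hu v h
    have hv : v ∉ A := fun hv => hDA v hv u h'
    exact hE' u v (hDE u v h hv) (hDE v u h' hu)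
  have hor : Firefighter.IsOrientation G D := by
    refine ⟨fun u v => ⟨fun h => ?_, ?_⟩, hasymm⟩
    · by_cases hu : u ∈ A
      · have hv : v ∉ A := fun hv => hind hu hv h.ne h
        exact Or.inr (Or.inr ⟨h.symm, hv, hu⟩)
      · by_cases hv : v ∈ A
        · exact Or.inl (Or.inr ⟨h, hu, hv⟩)
        · exact ((hE u v).1 ⟨h, hu, hv⟩).imp Or.inl Or.inl
    · rintro (h | h)
      exacts [hDG u v h, (hDG v u h).symm]
  have hout : ∀ v, (Finset.univ.filter (D.Adj v)).card ≤ 4 := fun v =>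
    hcard v _ fun w hw => hDG v w (by simpa using hw)
  -- An inneighbour takes up one of the four edges at `v`.
  have hout' : ∀ r v, D.Adj r v → (Finset.univ.filter (D.Adj v)).card ≤ 3 := by
    intro r v hrv
    have hr : r ∉ (Finset.univ.filter (D.Adj v)) := by simpa using hasymm r v hrv
    have := hcard v (insert r (Finset.univ.filter (D.Adj v))) (by
      intro w hw
      rcases Finset.mem_insert.1 hw with rfl | hw
      · exact (hDG _ _ hrv).symm
      · exact hDG v w (by simpa using hw))
    rw [Finset.card_insert_of_notMem hr] at this
    omega
  refine (iInf₂_le D hor).trans (iSup_le fun s => ?_)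
  rcases hEs s with hs | ⟨r, t, d, hrs, hst, hsd, htd, hs, ht⟩
  · exact Firefighter.betaAt_one_le_of_unique_arc_off_sinks hDA (hout s)
      (fun h => hasymm s s h h) fun w w' h h' hw hw' => hs w w' (hDE s w h hw) (hDE s w' h' hw')
  · exact Firefighter.betaAt_one_le_of_two_arcs_off_sinks hDA hasymm (Or.inl hst) (Or.inl hsd) htd
      (fun w h hw => hs w (hDE s w h hw))
      (fun w w' h h' hw hw' => ht w w' (hDE t w h hw) (hDE t w' h' hw'))
      (hout' r s (Or.inl hrs)) (hout' s t (Or.inl hst))
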